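/- Let $S=(M,J)$ be a compact complex surface. Let $\theta$ be a closed real $1$-form on $M$ and let $L=L_\theta$ be the flat real line bundle determined by $\theta$: if $(U_i)$ is an open cover of $M$ with smooth functions $f_i$ on $U_i$ such that $\theta|_{U_i}=df_i$, then $L$ has the locally constant positive transition functions $e^{f_i-f_j}$ on $U_i\cap U_j$. Let $L^*$ be its dual and $\mathcal L=L\otimes\mathbb C$ the corresponding flat holomorphic line bundle. Let $\sigma\in H^0(S,\mathcal K_S^*\otimes\mathcal L)$ be a holomorphic section, where $\mathcal K_S^*=\bigwedge^2T^{1,0}M$, and put $Q=\mathrm{Re}(\sigma)$, regarded as a map $Q:T^*M\to TM\otimes L$. Let $\omega\in\Omega^2(M,L^*)$ be a smooth real $L^*$-valued $2$-form, also regarded as the map $\omega:TM\to T^*M\otimes L^*$, $X\mapsto\omega(X,\cdot)$, which is $d_{L^*}$-closed (that is, closed in each of the above trivializations of $L^*$). Let $J^*$ act on $T^*M$ by $J^*\alpha=-\alpha\circ J$. Suppose that - the $J$-invariant part $\omega^{1,1}$ of $\omega$ is positive definite, i.e. $\omega^{1,1}(X,JX)>0$ for all $X\neq0$ (in each of the above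 trivializations of $L^*$); - $\omega J-J^*\omega+\omega Q\omega=0$. Then: (i) $J_-:=-J-Q\omega$ is a well-defined integrable complex structure on $M$, i.e. a smooth endomorphism field of $TM$ with $J_-^2=-1$ and vanishing Nijenhuis tensor; (ii) $g:=-\tfrac12\,\omega(J-J_-)$ is a smooth symmetric tensor field with values in $L^*$, and it defines a conformal class $c=[g]$ of Riemannian metrics on $M$: the smooth Riemannian metrics on $M$ which over each $U_i$ are a smooth positive multiple of the expression $g_i$ of $g$ in the trivialization over $U_i$ form exactly one conformal class; (iii) $J_+:=J$ and $J_-$ are orthogonal with respect to (every metric in) $c$, and $J_+(x)\neq J_-(x)$ for every $x\in M$. -/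

import Mathlib

open scoped Manifold ContDiff Bundle

namespace BiHermitian

section LinearAlgebra

variable {V : Type*} [AddCommGroup V] [Module ℂ V]

/-- Multiplication by `i`, as a real endomorphism. -/
noncomputable def mulI (V : Type*) [AddCommGroup V] [Module ℂ V] : V →ₗ[ℝ] V where
  toFun v := Complex.I • v
  map_add' := smul_add _
  map_smul' r v := smul_comm _ r v

/-- The action `J^* α = - α ∘ J` on real covectors. -/
noncomputable def mulIDual (V : Type*) [AddCommGroup V] [Module ℂ V] :
    Module.Dual ℝ V →ₗ[ℝ] Module.Dual ℝ V :=
  - (mulI V).dualMap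

/-- The `(1,0)`-part of a real covector, `α^{1,0}(v) = (α(v) - i α(iv)) / 2`, which is a
complex-linear form. -/
noncomputable def oneZeroPart (α : Module.Dual ℝ V) : Module.Dual ℂ V where
  toFun v := ((α v : ℂ) - Complex.I * (α (Complex.I • v) : ℂ)) / 2
  map_add' v w := by
    simp only [smul_add, map_add, Complex.ofReal_add]
    ring
  map_smul' c v := by
    have h1 : ∀ u : V, α (c • u) = c.re * α u + c.im * α (Complex.I • u) := by
      intro u
      have h2 : c • u = c.re • u + c.im • (Complex.I • u) := by
        conv_lhs => rw [← Complex.re_add_im c, add_smul, mul_smul]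
        rw [Complex.coe_smul, Complex.coe_smul]
      rw [h2, map_add, map_smul, map_smul, smul_eq_mul, smul_eq_mul]
    have h3 : α (Complex.I • c • v) = c.re * α (Complex.I • v) - c.im * α v := by
      rw [smul_comm, h1, smul_smul, Complex.I_mul_I, neg_one_smul, map_neg]
      ring
    rw [h1, h3]
    simp only [RingHom.id_apply, smul_eq_mul]
    push_cast
    have h4 := Complex.re_add_im c
    have h5 := Complex.I_sq
    rw [← h4]
    simp only [Complex.add_re, Complex.add_im, Complex.ofReal_re, Complex.ofReal_im,
      Complex.mul_re, Complex.mul_im, Complex.I_re, Complex.I_im]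
    ring_nf
    rw [h5]
    ring

theorem oneZeroPart_add (α β : Module.Dual ℝ V) :
    oneZeroPart (α + β) = oneZeroPart α + oneZeroPart β := by
  ext v
  simp only [oneZeroPart, LinearMap.coe_mk, AddHom.coe_mk, LinearMap.add_apply,
    Complex.ofReal_add]
  ring

theorem oneZeroPart_smul (r : ℝ) (α : Module.Dual ℝ V) :
    oneZeroPart (r • α) = (r : ℂ) • oneZeroPart α := by
  ext v
  simp only [oneZeroPart, LinearMap.coe_mk, AddHom.coe_mk, LinearMap.smul_apply,
    smul_eq_mul, Complex.ofReal_mul]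
  ring

/-- For a complex surface with tangent space `V`, the fibre `Λ² V = (Λ² V^*)^*` of the
anticanonical bundle, as the space of alternating complex bilinear forms on the complex dual
of `V`. -/
abbrev AntiCanonical (V : Type*) [AddCommGroup V] [Module ℂ V] : Type _ :=
  (Module.Dual ℂ V) [⋀^Fin 2]→ₗ[ℂ] ℂ

theorem vecTwo_add_right (σ : AntiCanonical V) (a b b' : Module.Dual ℂ V) :
    σ ![a, b + b'] = σ ![a, b] + σ ![a, b'] := by
  have h := σ.toMultilinearMap.map_update_add ![a, 0] 1 b b'
  have e : ∀ z, Function.update ![a, 0] 1 z = ![a, z] := by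
    intro z; ext i; fin_cases i <;> rfl
  simp only [e] at h
  exact h

theorem vecTwo_smul_right (σ : AntiCanonical V) (a b : Module.Dual ℂ V) (c : ℂ) :
    σ ![a, c • b] = c * σ ![a, b] := by
  have h := σ.toMultilinearMap.map_update_smul ![a, 0] 1 c b
  have e : ∀ z, Function.update ![a, 0] 1 z = ![a, z] := by
    intro z; ext i; fin_cases i <;> rfl
  simp only [e] at h
  exact h

/-- The real bivector `Re σ`, as a bilinear form on real covectors:
`(Re σ)(α, β) = Re (σ(α^{1,0}, β^{1,0}))`. -/
noncomputable def reBivector (σ : AntiCanonical V) :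
    Module.Dual ℝ V →ₗ[ℝ] Module.Dual ℝ V →ₗ[ℝ] ℝ :=
  LinearMap.mk₂ ℝ (fun α β => (σ ![oneZeroPart α, oneZeroPart β]).re)
    (fun α α' β => by
      have := σ.map_vecCons_add ![oneZeroPart β] (oneZeroPart α) (oneZeroPart α')
      simp [oneZeroPart_add, this])
    (fun r α β => by
      have := σ.map_vecCons_smul ![oneZeroPart β] (r : ℂ) (oneZeroPart α)
      simp only [oneZeroPart_smul, this]
      simp)
    (fun α β β' => by
      simp only [oneZeroPart_add, vecTwo_add_right, Complex.add_re])
    (fun r α β => by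
      simp only [oneZeroPart_smul, vecTwo_smul_right, Complex.re_ofReal_mul, smul_eq_mul])

/-- `Q = Re σ` as a map from covectors to vectors: `Q α` is the vector with
`β (Q α) = (Re σ)(α, β)` for every real covector `β`. -/
noncomputable def reMap [FiniteDimensional ℂ V] (σ : AntiCanonical V) :
    Module.Dual ℝ V →ₗ[ℝ] V :=
  (Module.evalEquiv ℝ V).symm.toLinearMap ∘ₗ reBivector σ

/-- The defining property of `reMap`. -/
theorem apply_reMap [FiniteDimensional ℂ V] (σ : AntiCanonical V) (α β : Module.Dual ℝ V) :
    β (reMap σ α) = (σ ![oneZeroPart α, oneZeroPart β]).re :=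
  Module.apply_evalEquiv_symm_apply (R := ℝ) (M := V) β (reBivector σ α)

/-- A real 2-form `Ω` as the map `v ↦ Ω(v, ·)` from vectors to covectors. -/
noncomputable def formMap [TopologicalSpace V] (Ω : V [⋀^Fin 2]→L[ℝ] ℝ) :
    V →ₗ[ℝ] Module.Dual ℝ V :=
  LinearMap.mk₂ ℝ (fun v w => Ω ![v, w])
    (fun v v' w => by
      have h := Ω.toMultilinearMap.map_update_add ![0, w] 0 v v'
      have e : ∀ z, Function.update ![0, w] 0 z = ![z, w] := by
        intro z; ext i; fin_cases i <;> rfl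
      simp only [e] at h
      exact h)
    (fun r v w => by
      have h := Ω.toMultilinearMap.map_update_smul ![0, w] 0 r v
      have e : ∀ z, Function.update ![0, w] 0 z = ![z, w] := by
        intro z; ext i; fin_cases i <;> rfl
      simp only [e] at h
      exact h)
    (fun v w w' => by
      have h := Ω.toMultilinearMap.map_update_add ![v, 0] 1 w w'
      have e : ∀ z, Function.update ![v, 0] 1 z = ![v, z] := by
        intro z; ext i; fin_cases i <;> rfl
      simp only [e] at h
      exact h)
    (fun r v w => by
      have h := Ω.toMultilinearMap.map_update_smul ![v, 0] 1 r w
      have e : ∀ z, Function.update ![v, 0] 1 z = ![v, z] := by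
        intro z; ext i; fin_cases i <;> rfl
      simp only [e] at h
      exact h)

/-- The `J`-invariant part of a real 2-form,
`Ω^{1,1}(v, w) = (Ω(v, w) + Ω(Jv, Jw)) / 2`. -/
noncomputable def invariantPart [TopologicalSpace V] (Ω : V [⋀^Fin 2]→L[ℝ] ℝ) (v w : V) : ℝ :=
  (Ω ![v, w] + Ω ![mulI V v, mulI V w]) / 2

/-- A `J`-invariant 2-form `F` is positive definite when the symmetric bilinear form
`F(·, J ·)` is; here `F` is the `J`-invariant part of `Ω`. -/
def InvariantPartPosDef [TopologicalSpace V] (Ω : V [⋀^Fin 2]→L[ℝ] ℝ) : Prop :=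
  ∀ v : V, v ≠ 0 → 0 < invariantPart Ω v (mulI V v)

end LinearAlgebra

section Manifold

variable {E : Type*} [NormedAddCommGroup E] [NormedSpace ℂ E]
  {M : Type*} [TopologicalSpace M] [ChartedSpace E M]

instance instFiniteDimensionalTangentSpace [FiniteDimensional ℂ E] (x : M) :
    FiniteDimensional ℂ (TangentSpace 𝓘(ℂ, E) x) :=
  inferInstanceAs (FiniteDimensional ℂ E)

/-- The smooth manifold underlying a complex manifold. -/
instance instIsManifoldReal [IsManifold 𝓘(ℂ, E) ∞ M] : IsManifold 𝓘(ℝ, E) ∞ M := by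
  refine isManifold_of_contDiffOn _ _ _ fun e e' he he' => ?_
  have h := (contDiffGroupoid ∞ 𝓘(ℂ, E)).compatible he he'
  rw [contDiffGroupoid, mem_groupoid_of_pregroupoid] at h
  exact ContDiffOn.restrict_scalars ℝ h.1

variable (E M) in
/-- The field of endomorphisms `J` of the tangent bundle of a complex manifold
(multiplication by `i`). -/
noncomputable def stdJ (x : M) :
    TangentSpace 𝓘(ℂ, E) x →ₗ[ℝ] TangentSpace 𝓘(ℂ, E) x :=
  mulI (TangentSpace 𝓘(ℂ, E) x)

/-- The differential at `x` of a holomorphic chart, as a complex-linear map. -/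
noncomputable def dChart (e : OpenPartialHomeomorph M E) (x : M) :
    TangentSpace 𝓘(ℂ, E) x →L[ℂ] E :=
  mfderiv 𝓘(ℂ, E) 𝓘(ℂ, E) e x

/-- The differential at `y` of the inverse of a holomorphic chart, as a complex-linear map. -/
noncomputable def dChartSymm (e : OpenPartialHomeomorph M E) (y : E) :
    E →L[ℂ] TangentSpace 𝓘(ℂ, E) (e.symm y) :=
  mfderiv 𝓘(ℂ, E) 𝓘(ℂ, E) e.symm y

/-- The expression in a chart of a real 2-form. -/
noncomputable def formInChart (e : OpenPartialHomeomorph M E)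
    (Ω : ∀ x : M, TangentSpace 𝓘(ℂ, E) x [⋀^Fin 2]→L[ℝ] ℝ) (y : E) : E [⋀^Fin 2]→L[ℝ] ℝ :=
  (Ω (e.symm y)).compContinuousLinearMap ((dChartSymm e y).restrictScalars ℝ)

/-- The expression in a chart of a field of endomorphisms of the tangent bundle. -/
noncomputable def endoInChart (e : OpenPartialHomeomorph M E)
    (A : ∀ x : M, TangentSpace 𝓘(ℂ, E) x →ₗ[ℝ] TangentSpace 𝓘(ℂ, E) x) (y : E) :
    E →ₗ[ℝ] E :=
  (dChart e (e.symm y)).toLinearMap.restrictScalars ℝ ∘ₗ A (e.symm y) ∘ₗ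
    (dChartSymm e y).toLinearMap.restrictScalars ℝ

/-- The expression in a chart of a field of real bilinear forms on the tangent bundle. -/
noncomputable def bilinInChart (e : OpenPartialHomeomorph M E)
    (g : ∀ x : M, TangentSpace 𝓘(ℂ, E) x →ₗ[ℝ] Module.Dual ℝ (TangentSpace 𝓘(ℂ, E) x))
    (y u v : E) : ℝ :=
  g (e.symm y) (dChartSymm e y u) (dChartSymm e y v)

/-- The expression in a chart of a section of `K^*`. -/
noncomputable def anticanonicalInChart (e : OpenPartialHomeomorph M E)
    (σ : ∀ x : M, AntiCanonical (TangentSpace 𝓘(ℂ, E) x)) (y : E) : AntiCanonical E :=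
  (σ (e.symm y)).compLinearMap (dChart e (e.symm y)).toLinearMap.dualMap

/-- The Nijenhuis bracket expression
`N_A(X, Y) = [AX, AY] - A[AX, Y] - A[X, AY] - [X, Y]` for an almost complex structure `A` on a
vector space. -/
noncomputable def nijenhuis (A : E → E →ₗ[ℝ] E) (X Y : E → E) (y : E) : E :=
  VectorField.lieBracket ℝ (fun z => A z (X z)) (fun z => A z (Y z)) y
    - A y (VectorField.lieBracket ℝ (fun z => A z (X z)) Y y)
    - A y (VectorField.lieBracket ℝ X (fun z => A z (Y z)) y)
    - VectorField.lieBracket ℝ X Y y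

/-- A smooth field `A` of endomorphisms of the tangent bundle is an integrable complex structure:
`A² = -1` and the Nijenhuis tensor of `A` vanishes. Since `N_A(X, Y)` is tensorial in `X` and
`Y`, its vanishing is tested on the coordinate vector fields of the charts. -/
structure IsIntegrableComplexStructure
    (A : ∀ x : M, TangentSpace 𝓘(ℂ, E) x →ₗ[ℝ] TangentSpace 𝓘(ℂ, E) x) : Prop where
  sq_eq_neg_one : ∀ x, A x ∘ₗ A x = - LinearMap.id
  smooth : ∀ e ∈ atlas E M, ∀ v : E, ContDiffOn ℝ ∞ (fun y => endoInChart e A y v) e.target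
  nijenhuis_eq_zero : ∀ e ∈ atlas E M, ∀ y ∈ e.target, ∀ u v : E,
    nijenhuis (endoInChart e A) (fun _ => u) (fun _ => v) y = 0

variable (E M) in
/-- A flat real line bundle `L = L_θ`: a closed real 1-form `θ` with local primitives `f i` on the
members `U i` of an open cover. The bundle `L` has over `U i ∩ U j` the locally constant positive
transition function `exp (f i - f j)`: a section of `L` is a family `s i` over `U i` with
`s i = exp (f i - f j) s j`, a section of the dual `L^*` is a family with
`s i = exp (f j - f i) s j`. -/
structure FlatRealLineBundle (ι : Type*) where
  θ : ∀ x : M, TangentSpace 𝓘(ℝ, E) x →L[ℝ] ℝ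
  U : ι → Set M
  isOpen_U : ∀ i, IsOpen (U i)
  iUnion_U : ⋃ i, U i = Set.univ
  f : ι → M → ℝ
  smooth_f : ∀ i, ContMDiffOn 𝓘(ℝ, E) 𝓘(ℝ, ℝ) ∞ (f i) (U i)
  mfderiv_f : ∀ i, ∀ x ∈ U i, mfderiv 𝓘(ℝ, E) 𝓘(ℝ, ℝ) (f i) x = θ x

variable {ι : Type*} (L : FlatRealLineBundle E M ι)

/-- The part of the target of a chart which corresponds to `U i`. -/
def FlatRealLineBundle.chartDomain (i : ι) (e : OpenPartialHomeomorph M E) : Set E :=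
  e.target ∩ e.symm ⁻¹' L.U i

/-- A holomorphic section of `K^* ⊗ 𝓛`, where `𝓛 = L ⊗ ℂ`. The values of `val i` outside `U i` are
irrelevant. -/
structure HolomorphicSection where
  val : ι → ∀ x : M, AntiCanonical (TangentSpace 𝓘(ℂ, E) x)
  glue : ∀ i j, ∀ x ∈ L.U i ∩ L.U j,
    val i x = (Real.exp (L.f i x - L.f j x) : ℂ) • val j x
  holomorphic : ∀ i, ∀ e ∈ atlas E M, ∀ α β : Module.Dual ℂ E,
    DifferentiableOn ℂ (fun y => anticanonicalInChart e (val i) y ![α, β]) (L.chartDomain i e)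

/-- A smooth real 2-form with values in `L^*`. The values of `val i` outside `U i` are
irrelevant. -/
structure DualValuedTwoForm where
  val : ι → ∀ x : M, TangentSpace 𝓘(ℂ, E) x [⋀^Fin 2]→L[ℝ] ℝ
  glue : ∀ i j, ∀ x ∈ L.U i ∩ L.U j, val i x = Real.exp (L.f j x - L.f i x) • val j x
  smooth : ∀ i, ∀ e ∈ atlas E M, ContDiffOn ℝ ∞ (formInChart e (val i)) (L.chartDomain i e)

variable {L}

/-- `d_{L^*} Ω = 0`: in each flat trivialization the operator `d_{L^*}` is the exterior
derivative. -/
def DualValuedTwoForm.IsClosed (Ω : DualValuedTwoForm L) : Prop :=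
  ∀ i, ∀ e ∈ atlas E M, ∀ y ∈ L.chartDomain i e, extDeriv (formInChart e (Ω.val i)) y = 0

variable (L) in
/-- The family `g i` (of which only the values over `U i` matter) is a smooth symmetric
covariant 2-tensor field with values in `L^*`. -/
structure IsDualValuedSymmetricTensor
    (g : ι → ∀ x : M, TangentSpace 𝓘(ℂ, E) x →ₗ[ℝ] Module.Dual ℝ (TangentSpace 𝓘(ℂ, E) x)) :
    Prop where
  glue : ∀ i j, ∀ x ∈ L.U i ∩ L.U j, g i x = Real.exp (L.f j x - L.f i x) • g j x
  smooth : ∀ i, ∀ e ∈ atlas E M, ∀ u v : E,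
    ContDiffOn ℝ ∞ (fun y => bilinInChart e (g i) y u v) (L.chartDomain i e)
  symm : ∀ i, ∀ x ∈ L.U i, ∀ v w, g i x v w = g i x w v

variable (E M) in
/-- Smooth Riemannian metrics on `M`. -/
abbrev RiemMetric [IsManifold 𝓘(ℂ, E) ∞ M] :=
  Bundle.ContMDiffRiemannianMetric 𝓘(ℝ, E) ∞ E (fun x : M => TangentSpace 𝓘(ℝ, E) x)

/-- A conformal class: the set of all smooth positive multiples of a Riemannian metric. -/
def IsConformalClass [IsManifold 𝓘(ℂ, E) ∞ M] (c : Set (RiemMetric E M)) : Prop :=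
  ∃ h₀ : RiemMetric E M, ∀ h : RiemMetric E M, h ∈ c ↔
    ∃ u : M → ℝ, ContMDiff 𝓘(ℝ, E) 𝓘(ℝ, ℝ) ∞ u ∧
      ∀ x, 0 < u x ∧ ∀ v w, h.inner x v w = u x * h₀.inner x v w

variable (L) in
/-- The set `[g]` of Riemannian metrics on `M` which in each trivialization of `L^*` are smooth
positive multiples of the `L^*`-valued tensor `g`. -/
def metricsOf [IsManifold 𝓘(ℂ, E) ∞ M]
    (g : ι → ∀ x : M, TangentSpace 𝓘(ℂ, E) x →ₗ[ℝ] Module.Dual ℝ (TangentSpace 𝓘(ℂ, E) x)) :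
    Set (RiemMetric E M) :=
  {h | ∀ i, ∃ u : M → ℝ, ContMDiffOn 𝓘(ℝ, E) 𝓘(ℝ, ℝ) ∞ u (L.U i) ∧
    ∀ x ∈ L.U i, 0 < u x ∧ ∀ v w : TangentSpace 𝓘(ℂ, E) x, h.inner x v w = u x * g i x v w}

/-- `A` is orthogonal with respect to every metric of `c`. -/
def IsOrthogonalFor [IsManifold 𝓘(ℂ, E) ∞ M]
    (A : ∀ x : M, TangentSpace 𝓘(ℂ, E) x →ₗ[ℝ] TangentSpace 𝓘(ℂ, E) x)
    (c : Set (RiemMetric E M)) : Prop :=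
  ∀ h ∈ c, ∀ x, ∀ v w : TangentSpace 𝓘(ℂ, E) x,
    h.inner x (A x v) (A x w) = h.inner x v w

end Manifold

end BiHermitian

/-! ### Linear algebra of the equation at one point. -/

namespace BiHermitian

section PointwiseAlgebra

variable {V : Type*} [AddCommGroup V] [Module ℂ V]

/-! Write `A` for `J_-`, and let `Ω` stand both for the form `ω` and for the map `v ↦ Ω(v, ·)`. By
the definition of `A`, the quadratic equation says exactly `Ω A = -J^* Ω`, that is `Ω(A v, w) = Ω(v,
J w)` (`HitchinEquation.formMap_minusJ`). The pointwise claims follow by algebra. `A² = -1` uses in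
addition that `Q J^* = -J Q`, because `Re σ` has type (2,0) + (0,2). The tensor `g` becomes
`Ω^{1,1}(·, J ·)`, hence is symmetric, positive and `J`-invariant. Moving `J` across `Ω` as `A`
turns the formula for `g` into one that is visibly `A`-invariant. If `J = A` at a point then `g = 0`
there, against positivity.

Integrability is a first-order computation in a chart (`nijenhuis_minusJ`). Positivity makes `Ω`
invertible, so it suffices to show `Ω(N_A(u, v), w) = 0` for constant `u`, `v`, `w`. With `D_W` the
derivative of `Ω` along `W`, differentiating `Ω(A v, w) = Ω(v, J w)` removes all derivatives of `A`,
and `dΩ = 0` reduces the result to `D_w(Au, Av) - D_w(u, v) - D_{Jw}(Au, v) - D_{Jw}(u, Av)`. The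
equation also expresses `Re σ(Ω u, Ω v)` through `Ω` and `J` alone. Hence the last two terms are the
derivative along `Jw` of `Re σ` on the frozen covectors `Ω u`, `Ω v` (`fderiv_reBivector`), and the
first two are the derivative along `w` of `Re σ` on `Ω u`, `J^* Ω v`, which is `Im σ` on `Ω u`, `Ω
v`. The sum vanishes by the Cauchy-Riemann equation for the holomorphic `σ`.

Globally, the transition factors of `L` and `L^*` cancel in `Q Ω`, so `A` is well defined, and
`exp(f i) g i` is independent of `i`: it is a Riemannian metric representing the conformal class. -/

theorem mulI_apply (v : V) : mulI V v = Complex.I • v := rfl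

theorem mulI_mulI (v : V) : mulI V (mulI V v) = -v := by
  simp [mulI_apply, smul_smul]

/-- A complex-linear form satisfies `a ∘ J = i a`; the sign in `J^* α = -α ∘ J` therefore gives
`-i`. -/
theorem oneZeroPart_mulIDual (α : Module.Dual ℝ V) :
    oneZeroPart (mulIDual V α) = (-Complex.I) • oneZeroPart α := by
  ext v
  have h : α (Complex.I • Complex.I • v) = - α v := by
    rw [smul_smul, Complex.I_mul_I, neg_one_smul, map_neg]
  simp only [oneZeroPart, mulIDual, LinearMap.coe_mk, AddHom.coe_mk, LinearMap.neg_apply,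
    LinearMap.dualMap_apply, mulI_apply, LinearMap.smul_apply, smul_eq_mul, h]
  push_cast
  linear_combination (-(α (Complex.I • v) : ℂ) / 2) * Complex.I_sq

theorem vecTwo_swap (σ : AntiCanonical V) (a b : Module.Dual ℂ V) :
    σ ![b, a] = - σ ![a, b] := by
  have h := σ.map_swap ![a, b] (i := 0) (j := 1) (by decide)
  rw [← h]
  congr 1
  ext i
  fin_cases i <;> rfl

section

variable [FiniteDimensional ℂ V]

theorem apply_reMap_swap (σ : AntiCanonical V) (α β : Module.Dual ℝ V) :
    β (reMap σ α) = - α (reMap σ β) := by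
  rw [apply_reMap, apply_reMap, vecTwo_swap, Complex.neg_re]

theorem apply_reMap_mulIDual (σ : AntiCanonical V) (α β : Module.Dual ℝ V) :
    mulIDual V β (reMap σ α) = (-Complex.I * σ ![oneZeroPart α, oneZeroPart β]).re := by
  rw [apply_reMap, oneZeroPart_mulIDual, vecTwo_smul_right]

/-- Since `σ` is complex bilinear, `J^*` contributes the same factor `-i` in either slot and can be
moved from one to the other. -/
theorem reMap_mulIDual (σ : AntiCanonical V) (α : Module.Dual ℝ V) :
    reMap σ (mulIDual V α) = - mulI V (reMap σ α) := by
  apply (Module.evalEquiv ℝ V).injective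
  ext β
  change β (reMap σ (mulIDual V α)) = β (- mulI V (reMap σ α))
  have h : β (- mulI V (reMap σ α)) = mulIDual V β (reMap σ α) := by
    rw [map_neg]; rfl
  rw [h, apply_reMap_mulIDual, apply_reMap_swap, apply_reMap_mulIDual,
    vecTwo_swap σ (oneZeroPart α), mul_neg, Complex.neg_re, neg_neg]

theorem reMap_smul (r : ℝ) (σ : AntiCanonical V) :
    reMap ((r : ℂ) • σ) = r • reMap σ := by
  refine LinearMap.ext fun α => (Module.evalEquiv ℝ V).injective (LinearMap.ext fun β => ?_)
  change β (reMap ((r : ℂ) • σ) α) = β (r • reMap σ α)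
  rw [map_smul, apply_reMap, apply_reMap, AlternatingMap.smul_apply, smul_eq_mul, smul_eq_mul,
    Complex.re_ofReal_mul]

end

variable [TopologicalSpace V]

theorem formMap_apply (Ω : V [⋀^Fin 2]→L[ℝ] ℝ) (v w : V) : formMap Ω v w = Ω ![v, w] := rfl

theorem formMap_swap (Ω : V [⋀^Fin 2]→L[ℝ] ℝ) (v w : V) :
    formMap Ω v w = - formMap Ω w v := by
  rw [formMap_apply, formMap_apply]
  have h := Ω.toAlternatingMap.map_swap ![w, v] (i := 0) (j := 1) (by decide)
  have e : ![w, v] ∘ Equiv.swap (0 : Fin 2) 1 = ![v, w] := by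
    ext i
    fin_cases i <;> rfl
  rw [e] at h
  exact h

theorem formMap_smul (r : ℝ) (Ω : V [⋀^Fin 2]→L[ℝ] ℝ) : formMap (r • Ω) = r • formMap Ω :=
  rfl

/-- The `J`-anti-invariant part of `Ω` vanishes on the pair `(v, Jv)`, so positivity of `Ω^{1,1}` is
positivity of `Ω` there. In particular `Ω` is nondegenerate. -/
theorem InvariantPartPosDef.formMap_pos {Ω : V [⋀^Fin 2]→L[ℝ] ℝ} (h : InvariantPartPosDef Ω)
    {v : V} (hv : v ≠ 0) : 0 < formMap Ω v (mulI V v) := by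
  have h1 := h v hv
  rw [invariantPart, ← formMap_apply, ← formMap_apply, mulI_mulI, map_neg,
    formMap_swap Ω (mulI V v) v] at h1
  linarith

theorem InvariantPartPosDef.formMap_injective {Ω : V [⋀^Fin 2]→L[ℝ] ℝ}
    (h : InvariantPartPosDef Ω) : Function.Injective (formMap Ω) := by
  rw [← LinearMap.ker_eq_bot, LinearMap.ker_eq_bot']
  intro v hv
  by_contra hne
  have := h.formMap_pos hne
  rw [hv] at this
  exact lt_irrefl _ this

variable [FiniteDimensional ℂ V]

/-- The algebraic equation `Ω J - J^* Ω + Ω Q Ω = 0` at a point, where `Q = Re σ`. -/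
def HitchinEquation (σ : AntiCanonical V) (Ω : V [⋀^Fin 2]→L[ℝ] ℝ) : Prop :=
  formMap Ω ∘ₗ mulI V - mulIDual V ∘ₗ formMap Ω + formMap Ω ∘ₗ reMap σ ∘ₗ formMap Ω = 0

/-- The endomorphism `J_- = - J - Q Ω`. -/
noncomputable def minusJ (σ : AntiCanonical V) (Ω : V [⋀^Fin 2]→L[ℝ] ℝ) : V →ₗ[ℝ] V :=
  - mulI V - reMap σ ∘ₗ formMap Ω

theorem minusJ_apply (σ : AntiCanonical V) (Ω : V [⋀^Fin 2]→L[ℝ] ℝ) (v : V) :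
    minusJ σ Ω v = - mulI V v - reMap σ (formMap Ω v) := rfl

/-- The symmetric bilinear form `g = - Ω (J - J_-) / 2`. -/
noncomputable def hermitianForm (Ω : V [⋀^Fin 2]→L[ℝ] ℝ) (K : V →ₗ[ℝ] V) :
    V →ₗ[ℝ] Module.Dual ℝ V :=
  (-(1 / 2) : ℝ) • (formMap Ω ∘ₗ (mulI V - K))

variable {σ : AntiCanonical V} {Ω : V [⋀^Fin 2]→L[ℝ] ℝ}

theorem HitchinEquation.apply (h : HitchinEquation σ Ω) (v w : V) :
    formMap Ω (mulI V v) w + formMap Ω v (mulI V w)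
      + formMap Ω (reMap σ (formMap Ω v)) w = 0 := by
  have h1 := LinearMap.congr_fun (LinearMap.congr_fun h v) w
  have h2 : mulIDual V (formMap Ω v) w = - formMap Ω v (mulI V w) := rfl
  simp only [LinearMap.add_apply, LinearMap.sub_apply, LinearMap.comp_apply,
    LinearMap.zero_apply, h2] at h1
  linarith

/-- The equation in its working form: `J_-` moves across `Ω` and becomes `J`. -/
theorem HitchinEquation.formMap_minusJ (h : HitchinEquation σ Ω) (v w : V) :
    formMap Ω (minusJ σ Ω v) w = formMap Ω v (mulI V w) := by
  have h1 := h.apply v w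
  rw [minusJ_apply, map_sub, map_neg, LinearMap.sub_apply, LinearMap.neg_apply]
  linarith

theorem HitchinEquation.formMap_minusJ_right (h : HitchinEquation σ Ω) (v w : V) :
    formMap Ω v (minusJ σ Ω w) = formMap Ω (mulI V v) w := by
  rw [formMap_swap, h.formMap_minusJ, ← formMap_swap]

theorem HitchinEquation.formMap_minusJ_eq (h : HitchinEquation σ Ω) (v : V) :
    formMap Ω (minusJ σ Ω v) = - mulIDual V (formMap Ω v) := by
  ext w
  rw [h.formMap_minusJ]
  simp [mulIDual]

/-- From `Ω J_- = -J^* Ω` and `Q J^* = -J Q` one gets `J_-² = -J J_- - J Q Ω = J²`. -/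
theorem HitchinEquation.minusJ_minusJ (h : HitchinEquation σ Ω) (v : V) :
    minusJ σ Ω (minusJ σ Ω v) = - v := by
  rw [minusJ_apply σ Ω (minusJ σ Ω v), h.formMap_minusJ_eq, map_neg, reMap_mulIDual,
    minusJ_apply, map_sub, map_neg, mulI_mulI]
  abel

theorem HitchinEquation.apply_reMap_formMap (h : HitchinEquation σ Ω) (v w : V) :
    formMap Ω w (reMap σ (formMap Ω v))
      = formMap Ω (mulI V v) w + formMap Ω v (mulI V w) := by
  have := h.apply v w
  rw [formMap_swap]
  linarith

/-- The right-hand side is `Ω^{1,1}(v, J w)`. It contains neither `σ` nor `J_-`, which yields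
symmetry, positivity and later smoothness. -/
theorem HitchinEquation.hermitianForm_apply (h : HitchinEquation σ Ω) (v w : V) :
    hermitianForm Ω (minusJ σ Ω) v w
      = (formMap Ω v (mulI V w) - formMap Ω (mulI V v) w) / 2 := by
  have h1 := h.formMap_minusJ v w
  simp only [hermitianForm, LinearMap.smul_apply, LinearMap.comp_apply, LinearMap.sub_apply,
    map_sub, smul_eq_mul, h1]
  ring

theorem HitchinEquation.hermitianForm_symm (h : HitchinEquation σ Ω) (v w : V) :
    hermitianForm Ω (minusJ σ Ω) v w = hermitianForm Ω (minusJ σ Ω) w v := by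
  rw [h.hermitianForm_apply, h.hermitianForm_apply, formMap_swap Ω (mulI V v) w,
    formMap_swap Ω v]
  ring

theorem HitchinEquation.hermitianForm_pos (h : HitchinEquation σ Ω)
    (hp : InvariantPartPosDef Ω) {v : V} (hv : v ≠ 0) :
    0 < hermitianForm Ω (minusJ σ Ω) v v := by
  have h1 := hp.formMap_pos hv
  rw [h.hermitianForm_apply, formMap_swap Ω (mulI V v) v]
  linarith

theorem HitchinEquation.hermitianForm_mulI (h : HitchinEquation σ Ω) (v w : V) :
    hermitianForm Ω (minusJ σ Ω) (mulI V v) (mulI V w) = hermitianForm Ω (minusJ σ Ω) v w := by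
  rw [h.hermitianForm_apply, h.hermitianForm_apply, mulI_mulI, mulI_mulI, map_neg, map_neg,
    LinearMap.neg_apply]
  ring

/-- Moving `J` across `Ω` gives `g(v, w) = (Ω(J_- v, w) - Ω(v, J_- w)) / 2`, which `J_-` preserves
because `J_-² = -1`. -/
theorem HitchinEquation.hermitianForm_minusJ (h : HitchinEquation σ Ω) (v w : V) :
    hermitianForm Ω (minusJ σ Ω) (minusJ σ Ω v) (minusJ σ Ω w)
      = hermitianForm Ω (minusJ σ Ω) v w := by
  rw [h.hermitianForm_apply, h.hermitianForm_apply, ← h.formMap_minusJ, h.minusJ_minusJ,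
    ← h.formMap_minusJ_right, h.minusJ_minusJ, h.formMap_minusJ_right, ← h.formMap_minusJ v w]
  have h1 : formMap Ω (mulI V (minusJ σ Ω v)) (minusJ σ Ω w)
      = - formMap Ω (minusJ σ Ω v) w := by
    rw [h.formMap_minusJ_right, mulI_mulI, map_neg, LinearMap.neg_apply]
  simp only [map_neg, LinearMap.neg_apply] at *
  linarith

theorem HitchinEquation.mulI_ne_minusJ [Nontrivial V] (h : HitchinEquation σ Ω)
    (hp : InvariantPartPosDef Ω) : mulI V ≠ minusJ σ Ω := by
  intro he
  obtain ⟨v, hv⟩ := exists_ne (0 : V)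
  have h1 := h.hermitianForm_pos hp hv
  rw [hermitianForm, ← he, sub_self, LinearMap.comp_zero, smul_zero] at h1
  exact lt_irrefl _ h1

end PointwiseAlgebra

end BiHermitian

/-! ### Calculus on an open subset of the model space: smoothness and integrability of `J_-`. -/

namespace BiHermitian

section LocalComputation

open ContinuousLinearMap (inverse)

variable {E : Type*} [NormedAddCommGroup E] [NormedSpace ℂ E] [FiniteDimensional ℂ E]

/-- A bilinear form on a finite-dimensional space as a continuous bilinear form. -/
noncomputable def bilinCLM (b : E →ₗ[ℝ] Module.Dual ℝ E) : E →L[ℝ] E →L[ℝ] ℝ :=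
  (LinearMap.toContinuousLinearMap.toLinearMap ∘ₗ b).toContinuousLinearMap

/-- A 2-form as a continuous linear map from vectors to covectors. -/
noncomputable def formCLM (Ω : E [⋀^Fin 2]→L[ℝ] ℝ) : E →L[ℝ] E →L[ℝ] ℝ :=
  bilinCLM (formMap Ω)

theorem formCLM_apply (Ω : E [⋀^Fin 2]→L[ℝ] ℝ) (u v : E) : formCLM Ω u v = formMap Ω u v := rfl

theorem InvariantPartPosDef.exists_equiv {Ω : E [⋀^Fin 2]→L[ℝ] ℝ} (h : InvariantPartPosDef Ω) :
    ∃ e : E ≃L[ℝ] (E →L[ℝ] ℝ), (e : E →L[ℝ] E →L[ℝ] ℝ) = formCLM Ω := by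
  have hinj : Function.Injective (formCLM Ω).toLinearMap := fun u v huv =>
    h.formMap_injective (LinearMap.ext fun w => congrArg (fun f : E →L[ℝ] ℝ => f w) huv)
  have hdim : Module.finrank ℝ E = Module.finrank ℝ (E →L[ℝ] ℝ) := by
    rw [← (LinearMap.toContinuousLinearMap (𝕜 := ℝ) (E := E) (F' := ℝ)).finrank_eq]
    exact (Subspace.dual_finrank_eq (K := ℝ) (V := E)).symm
  exact ⟨(LinearMap.linearEquivOfInjective _ hinj hdim).toContinuousLinearEquiv, by ext; rfl⟩

variable {s : Set E} {η : E → E [⋀^Fin 2]→L[ℝ] ℝ}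

theorem contDiffOn_formCLM (hη : ContDiffOn ℝ ∞ η s) :
    ContDiffOn ℝ ∞ (fun z => formCLM (η z)) s := by
  rw [contDiffOn_clm_apply]
  intro u
  rw [contDiffOn_clm_apply]
  intro v
  exact (ContinuousAlternatingMap.apply ℝ E ℝ ![u, v]).contDiff.comp_contDiffOn hη

set_option synthInstance.maxHeartbeats 200000 in
theorem contDiffOn_inverse_formCLM (hη : ContDiffOn ℝ ∞ η s)
    (hp : ∀ z ∈ s, InvariantPartPosDef (η z)) :
    ContDiffOn ℝ ∞ (fun z => inverse (formCLM (η z))) s := by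
  intro z hz
  obtain ⟨e, he⟩ := (hp z hz).exists_equiv
  have h := contDiffAt_map_inverse (n := ∞) e
  rw [he] at h
  exact h.comp_contDiffWithinAt z (contDiffOn_formCLM hη z hz)

theorem formCLM_inverse {Ω : E [⋀^Fin 2]→L[ℝ] ℝ} (h : InvariantPartPosDef Ω) (α : E →L[ℝ] ℝ) :
    formCLM Ω (inverse (formCLM Ω) α) = α := by
  obtain ⟨e, he⟩ := h.exists_equiv
  rw [← he, ContinuousLinearMap.inverse_equiv]
  exact e.apply_symm_apply α

theorem inverse_formCLM {Ω : E [⋀^Fin 2]→L[ℝ] ℝ} (h : InvariantPartPosDef Ω) (v : E) :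
    inverse (formCLM Ω) (formCLM Ω v) = v := by
  obtain ⟨e, he⟩ := h.exists_equiv
  rw [← he, ContinuousLinearMap.inverse_equiv]
  exact e.symm_apply_apply v

variable {σ : E → AntiCanonical E}

/-- Smoothness comes from `Ω` alone, through `J_- v = Ω⁻¹(Ω(v, J ·))`. -/
theorem contDiffOn_minusJ (hη : ContDiffOn ℝ ∞ η s)
    (hp : ∀ z ∈ s, InvariantPartPosDef (η z)) (hr : ∀ z ∈ s, HitchinEquation (σ z) (η z)) (v : E) :
    ContDiffOn ℝ ∞ (fun z => minusJ (σ z) (η z) v) s := by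
  have h1 : ContDiffOn ℝ ∞ (fun z => inverse (formCLM (η z))
      ((formCLM (η z) v).comp (mulI E).toContinuousLinearMap)) s :=
    (contDiffOn_inverse_formCLM hη hp).clm_apply
      (((contDiffOn_formCLM hη).clm_apply contDiffOn_const).clm_comp contDiffOn_const)
  refine h1.congr fun z hz => ?_
  have h2 : (formCLM (η z) v).comp (mulI E).toContinuousLinearMap
      = formCLM (η z) (minusJ (σ z) (η z) v) := by
    ext w
    exact ((hr z hz).formMap_minusJ v w).symm
  rw [h2, inverse_formCLM (hp z hz)]

variable {y : E}

-- The product rule. The derivative is given by its values, so that uniqueness of derivatives turns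
-- identities between functions into scalar identities ready for `linarith`.
set_option synthInstance.maxHeartbeats 200000 in
theorem hasFDerivAt_formMap (hs : IsOpen s) (hη : ContDiffOn ℝ ∞ η s) (hy : y ∈ s) {X Y : E → E}
    {X' Y' : E →L[ℝ] E} (hX : HasFDerivAt X X' y) (hY : HasFDerivAt Y Y' y) :
    ∃ F : E →L[ℝ] ℝ, HasFDerivAt (fun z => formMap (η z) (X z) (Y z)) F y ∧
      ∀ W, F W = fderiv ℝ (fun z => formCLM (η z)) y W (X y) (Y y)
        + formMap (η y) (X' W) (Y y) + formMap (η y) (X y) (Y' W) := by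
  have h0 : HasFDerivAt (fun z => formCLM (η z)) (fderiv ℝ (fun z => formCLM (η z)) y) y :=
    (((contDiffOn_formCLM hη).contDiffAt (hs.mem_nhds hy)).differentiableAt (by simp)).hasFDerivAt
  refine ⟨_, (h0.clm_apply hX).clm_apply hY, fun W => ?_⟩
  simp [← formCLM_apply]
  ring

theorem fderiv_formCLM_apply (hs : IsOpen s) (hη : ContDiffOn ℝ ∞ η s) (hy : y ∈ s) (W u v : E) :
    fderiv ℝ (fun z => formCLM (η z)) y W u v = fderiv ℝ η y W ![u, v] := by
  obtain ⟨F, hF, hF'⟩ := hasFDerivAt_formMap hs hη hy (hasFDerivAt_const u y)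
    (hasFDerivAt_const v y)
  have h1 : HasFDerivAt η (fderiv ℝ η y) y :=
    ((hη.contDiffAt (hs.mem_nhds hy)).differentiableAt (by simp)).hasFDerivAt
  have h2 := (ContinuousAlternatingMap.apply ℝ E ℝ ![u, v]).hasFDerivAt.comp y h1
  have h3 := congrArg (fun f : E →L[ℝ] ℝ => f W) (hF.unique h2)
  rw [hF'] at h3
  simpa using h3

theorem fderiv_formCLM_swap (hs : IsOpen s) (hη : ContDiffOn ℝ ∞ η s) (hy : y ∈ s) (W u v : E) :
    fderiv ℝ (fun z => formCLM (η z)) y W u v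
      = - fderiv ℝ (fun z => formCLM (η z)) y W v u := by
  rw [fderiv_formCLM_apply hs hη hy, fderiv_formCLM_apply hs hη hy]
  exact formMap_swap (fderiv ℝ η y W) u v

theorem fderiv_formCLM_cyclic (hs : IsOpen s) (hη : ContDiffOn ℝ ∞ η s) (hy : y ∈ s)
    (hd : extDeriv η y = 0) (a b c : E) :
    fderiv ℝ (fun z => formCLM (η z)) y a b c + fderiv ℝ (fun z => formCLM (η z)) y b c a
      + fderiv ℝ (fun z => formCLM (η z)) y c a b = 0 := by
  have h := (ContinuousAlternatingMap.alternatizeUncurryFin_apply (fderiv ℝ η y)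
    ![a, b, c]).trans (Fin.sum_univ_three _)
  rw [← extDeriv, hd] at h
  have e0 : Fin.removeNth (0 : Fin 3) ![a, b, c] = ![b, c] := by
    ext i; fin_cases i <;> rfl
  have e1 : Fin.removeNth (1 : Fin 3) ![a, b, c] = ![a, c] := by
    ext i; fin_cases i <;> rfl
  have e2 : Fin.removeNth (2 : Fin 3) ![a, b, c] = ![a, b] := by
    ext i; fin_cases i <;> rfl
  rw [e0, e1, e2] at h
  rw [fderiv_formCLM_swap hs hη hy b, fderiv_formCLM_apply hs hη hy,
    fderiv_formCLM_apply hs hη hy, fderiv_formCLM_apply hs hη hy]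
  simp at h
  linarith

/-- Derivative of the equation `Ω(J_- v, w) = Ω(v, J w)`. -/
theorem formMap_fderiv_minusJ (hs : IsOpen s) (hη : ContDiffOn ℝ ∞ η s) (hy : y ∈ s)
    (hp : ∀ z ∈ s, InvariantPartPosDef (η z)) (hr : ∀ z ∈ s, HitchinEquation (σ z) (η z))
    (v w W : E) :
    formMap (η y) (fderiv ℝ (fun z => minusJ (σ z) (η z) v) y W) w
      = fderiv ℝ (fun z => formCLM (η z)) y W v (mulI E w)
        - fderiv ℝ (fun z => formCLM (η z)) y W (minusJ (σ y) (η y) v) w := by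
  have hA := (((contDiffOn_minusJ hη hp hr v).contDiffAt
    (hs.mem_nhds hy)).differentiableAt (by simp)).hasFDerivAt
  obtain ⟨F, hF, hF'⟩ := hasFDerivAt_formMap hs hη hy hA (hasFDerivAt_const w y)
  obtain ⟨G, hG, hG'⟩ := hasFDerivAt_formMap hs hη hy (hasFDerivAt_const v y)
    (hasFDerivAt_const (mulI E w) y)
  have h : (fun z => formMap (η z) v (mulI E w))
      =ᶠ[nhds y] fun z => formMap (η z) (minusJ (σ z) (η z) v) w := by
    filter_upwards [hs.mem_nhds hy] with z hz
    exact ((hr z hz).formMap_minusJ v w).symm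
  have h3 := congrArg (fun f : E →L[ℝ] ℝ => f W) (hG.unique (hF.congr_of_eventuallyEq h))
  simp only [hF', hG', _root_.zero_apply, map_zero, LinearMap.zero_apply] at h3
  linarith

/-- Derivative of the real part of the bivector along the covectors `Ω u`, `Ω v`. -/
theorem fderiv_reBivector (hs : IsOpen s) (hη : ContDiffOn ℝ ∞ η s) (hy : y ∈ s)
    (hp : ∀ z ∈ s, InvariantPartPosDef (η z)) (hr : ∀ z ∈ s, HitchinEquation (σ z) (η z))
    (u v W : E) {F : E →L[ℝ] ℝ}
    (hF : HasFDerivAt (fun z => reBivector (σ z) (formMap (η y) u) (formMap (η y) v)) F y) :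
    F W = - fderiv ℝ (fun z => formCLM (η z)) y W u (minusJ (σ y) (η y) v)
      - fderiv ℝ (fun z => formCLM (η z)) y W (minusJ (σ y) (η y) u) v := by
  have hi := (((contDiffOn_inverse_formCLM hη hp).contDiffAt
    (hs.mem_nhds hy)).differentiableAt (by simp)).hasFDerivAt
  -- `X z = Ω_z⁻¹(Ω_y u)` keeps the covector `Ω_z (X z)` frozen at its value at `y`. Differentiating
  -- this constancy determines `Ω(X' W, ·)`.
  have hX : ∀ u : E, ∃ (X : E → E) (X' : E →L[ℝ] E), HasFDerivAt X X' y ∧ X y = u ∧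
      (∀ z ∈ s, formMap (η z) (X z) = formMap (η y) u) ∧
      ∀ w, formMap (η y) (X' W) w = - fderiv ℝ (fun z => formCLM (η z)) y W u w := by
    intro u
    have hX := hi.clm_apply (hasFDerivAt_const (formCLM (η y) u) y)
    have h1 : ∀ z ∈ s, formMap (η z) (inverse (formCLM (η z)) (formCLM (η y) u))
        = formMap (η y) u := fun z hz => LinearMap.ext fun w =>
      congrArg (fun f : E →L[ℝ] ℝ => f w) (formCLM_inverse (hp z hz) (formCLM (η y) u))
    refine ⟨_, _, hX, inverse_formCLM (hp y hy) u, h1, fun w => ?_⟩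
    obtain ⟨G, hG, hG'⟩ := hasFDerivAt_formMap hs hη hy hX (hasFDerivAt_const w y)
    have h : (fun z => formMap (η z) (inverse (formCLM (η z)) (formCLM (η y) u)) w)
        =ᶠ[nhds y] fun _ => formMap (η y) u w := by
      filter_upwards [hs.mem_nhds hy] with z hz
      rw [h1 z hz]
    have h3 := congrArg (fun f : E →L[ℝ] ℝ => f W)
      (((hasFDerivAt_const _ y).congr_of_eventuallyEq h).unique hG)
    simp only [hG', inverse_formCLM (hp y hy), _root_.zero_apply, map_zero] at h3
    linarith
  obtain ⟨X, X', hXd, hXy, hXs, hX'⟩ := hX u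
  obtain ⟨Y, Y', hYd, hYy, hYs, hY'⟩ := hX v
  have hJ : ∀ {X : E → E} {X' : E →L[ℝ] E}, HasFDerivAt X X' y →
      HasFDerivAt (fun z => mulI E (X z)) ((mulI E).toContinuousLinearMap.comp X') y :=
    fun h => (mulI E).toContinuousLinearMap.hasFDerivAt.comp y h
  obtain ⟨G, hG, hG'⟩ := hasFDerivAt_formMap hs hη hy (hJ hXd) hYd
  obtain ⟨H, hH, hH'⟩ := hasFDerivAt_formMap hs hη hy hXd (hJ hYd)
  -- Along these fields the quadratic equation writes `Re σ` as `Ω(JX, Y) + Ω(X, JY)`.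
  have h : (fun z => reBivector (σ z) (formMap (η y) u) (formMap (η y) v)) =ᶠ[nhds y]
      fun z => formMap (η z) (mulI E (X z)) (Y z) + formMap (η z) (X z) (mulI E (Y z)) := by
    filter_upwards [hs.mem_nhds hy] with z hz
    rw [← (hr z hz).apply_reMap_formMap, hXs z hz, hYs z hz, apply_reMap]
    rfl
  have h3 := congrArg (fun f : E →L[ℝ] ℝ => f W)
    (hF.unique ((hG.add hH).congr_of_eventuallyEq h))
  -- The terms `D_W(Ju, v)` and `D_W(u, Jv)` cancel against `Ω(Ju, Y')` and `Ω(X', Jv)`; the other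
  -- two terms give the claim after `J` is moved across `Ω` as `J_-`.
  have hry := hr y hy
  have k1 := hX' (mulI E v)
  have k2 := hX' (minusJ (σ y) (η y) v)
  have k3 := hY' (minusJ (σ y) (η y) u)
  have k4 := hY' (mulI E u)
  have k5 := hry.formMap_minusJ_right (X' W) v
  have k6 := hry.formMap_minusJ_right (Y' W) u
  have c1 := formMap_swap (η y) (mulI E u) (Y' W)
  have c2 := formMap_swap (η y) u (mulI E (Y' W))
  have c3 := formMap_swap (η y) (mulI E (Y' W)) u
  have d1 := fderiv_formCLM_swap hs hη hy W v (minusJ (σ y) (η y) u)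
  have d2 := fderiv_formCLM_swap hs hη hy W v (mulI E u)
  simp only [_root_.add_apply, hG', hH', hXy, hYy, ContinuousLinearMap.comp_apply,
    LinearMap.coe_toContinuousLinearMap'] at h3
  linarith

omit [FiniteDimensional ℂ E] in
/-- The real part of a holomorphic bivector satisfies a Cauchy-Riemann equation. -/
theorem exists_fderiv_reBivector {α β : Module.Dual ℝ E}
    (h : DifferentiableAt ℂ (fun z => σ z ![oneZeroPart α, oneZeroPart β]) y) :
    ∃ F G : E →L[ℝ] ℝ, HasFDerivAt (fun z => reBivector (σ z) α β) F y ∧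
      HasFDerivAt (fun z => reBivector (σ z) α (mulIDual E β)) G y ∧
      ∀ W, F (mulI E W) + G W = 0 := by
  have h1 := h.hasFDerivAt.restrictScalars ℝ
  have h2 := ((h.hasFDerivAt.const_mul (-Complex.I)).restrictScalars ℝ)
  refine ⟨_, _, Complex.reCLM.hasFDerivAt.comp y h1,
    (Complex.reCLM.hasFDerivAt.comp y h2).congr_of_eventuallyEq (.of_forall fun z => ?_),
    fun W => ?_⟩
  · change (σ z ![oneZeroPart α, oneZeroPart (mulIDual E β)]).re = _
    rw [oneZeroPart_mulIDual, vecTwo_smul_right]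
    rfl
  · simp [mulI_apply]

/-- Paired with `w` under `Ω`, the Nijenhuis expression becomes `F(Jw) + G(w)`, where `F` and `G`
are the derivatives of the real and imaginary parts of `σ` on frozen covectors. -/
theorem nijenhuis_minusJ (hs : IsOpen s) (hη : ContDiffOn ℝ ∞ η s) (hy : y ∈ s)
    (hd : extDeriv η y = 0)
    (hp : ∀ z ∈ s, InvariantPartPosDef (η z)) (hr : ∀ z ∈ s, HitchinEquation (σ z) (η z))
    (hσ : ∀ α β : Module.Dual ℂ E, DifferentiableAt ℂ (fun z => σ z ![α, β]) y) (u v : E) :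
    nijenhuis (fun z => minusJ (σ z) (η z)) (fun _ => u) (fun _ => v) y = 0 := by
  have hry := hr y hy
  apply (hp y hy).formMap_injective
  ext w
  set A := minusJ (σ y) (η y) with hA
  have hc := fderiv_formCLM_cyclic hs hη hy hd
  have hsw := fderiv_formCLM_swap hs hη hy
  have hD := formMap_fderiv_minusJ hs hη hy hp hr
  obtain ⟨F, G, hF, hG, hFG⟩ := exists_fderiv_reBivector
    (hσ (oneZeroPart (formMap (η y) u)) (oneZeroPart (formMap (η y) v)))
  have hF1 := fderiv_reBivector hs hη hy hp hr u v (mulI E w) hF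
  -- Because `Ω J_- v = -J^* Ω v`, the derivative for the pair `u`, `A v` is `-G`.
  have hG1 := fderiv_reBivector hs hη hy hp hr u (A v) w (F := -G) (by
    simp only [hA, hry.formMap_minusJ_eq v, map_neg]
    exact hG.neg)
  have hAA : A (A v) = -v := hry.minusJ_minusJ v
  have hAl : ∀ a b, formMap (η y) (A a) b = formMap (η y) a (mulI E b) := hry.formMap_minusJ
  have hfg := hFG w
  simp only [nijenhuis, VectorField.lieBracket, fderiv_const_apply,
    _root_.zero_apply, sub_zero, zero_sub, sub_self, map_sub, map_neg,
    LinearMap.sub_apply, LinearMap.neg_apply, map_zero, LinearMap.zero_apply]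
  rw [← hA, hAl, hAl]
  simp only [hD, ← hA, mulI_mulI, map_neg]
  rw [← hA, hAA] at hG1
  rw [← hA] at hF1
  simp only [map_neg, _root_.neg_apply] at hG1
  -- Closedness on these four triples trades the derivatives along `u`, `v`, `Au`, `Av` for
  -- derivatives along `w` and `Jw`.
  have c1 := hc (A u) (A v) w
  have c2 := hc u v w
  have c3 := hc (A u) v (mulI E w)
  have c4 := hc u (A v) (mulI E w)
  have s1 := hsw (A v) w (A u)
  have s2 := hsw v w u
  have s3 := hsw v (mulI E w) (A u)
  have s4 := hsw (A v) (mulI E w) u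
  linarith

end LocalComputation

end BiHermitian

/-! ### Naturality of the algebraic data under complex-linear isomorphisms. -/

namespace BiHermitian

section Pullback

variable {V V' : Type*} [AddCommGroup V] [Module ℂ V] [AddCommGroup V'] [Module ℂ V']

theorem oneZeroPart_comp (φ : V →ₗ[ℂ] V') (α : Module.Dual ℝ V') :
    oneZeroPart (α ∘ₗ φ.restrictScalars ℝ) = φ.dualMap (oneZeroPart α) := by
  ext v
  simp [oneZeroPart]

theorem reMap_compLinearMap [FiniteDimensional ℂ V] [FiniteDimensional ℂ V']
    (σ : AntiCanonical V) (φ : V →ₗ[ℂ] V') (α : Module.Dual ℝ V') :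
    reMap (σ.compLinearMap φ.dualMap) α = φ (reMap σ (α ∘ₗ φ.restrictScalars ℝ)) := by
  apply (Module.evalEquiv ℝ V').injective
  ext β
  change β (reMap (σ.compLinearMap φ.dualMap) α)
    = (β ∘ₗ φ.restrictScalars ℝ) (reMap σ (α ∘ₗ φ.restrictScalars ℝ))
  rw [apply_reMap, apply_reMap, oneZeroPart_comp, oneZeroPart_comp,
    AlternatingMap.compLinearMap_apply]
  congr 2
  ext i
  fin_cases i <;> rfl

variable [TopologicalSpace V] [TopologicalSpace V']

theorem formMap_compContinuousLinearMap (Ω : V [⋀^Fin 2]→L[ℝ] ℝ) (ψ : V' →L[ℝ] V) (u v : V') :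
    formMap (Ω.compContinuousLinearMap ψ) u v = formMap Ω (ψ u) (ψ v) := by
  rw [formMap_apply, formMap_apply, ContinuousAlternatingMap.compContinuousLinearMap_apply]
  congr 1
  ext i
  fin_cases i <;> rfl

theorem InvariantPartPosDef.comp {Ω : V [⋀^Fin 2]→L[ℝ] ℝ} (h : InvariantPartPosDef Ω)
    {ψ : V' →L[ℂ] V} (hψ : Function.Injective ψ) :
    InvariantPartPosDef (Ω.compContinuousLinearMap (ψ.restrictScalars ℝ)) := by
  intro v hv
  have h1 := h (ψ v) (fun h0 => hv (hψ (h0.trans (map_zero ψ).symm)))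
  rw [invariantPart, ← formMap_apply, ← formMap_apply] at h1 ⊢
  rw [formMap_compContinuousLinearMap, formMap_compContinuousLinearMap]
  simpa [mulI_apply] using h1

variable [FiniteDimensional ℂ V] [FiniteDimensional ℂ V'] {φ : V →L[ℂ] V'} {ψ : V' →L[ℂ] V}

theorem reMap_formMap_comp (hψφ : ∀ v, ψ (φ v) = v) (σ : AntiCanonical V)
    (Ω : V [⋀^Fin 2]→L[ℝ] ℝ) (u : V') :
    reMap (σ.compLinearMap φ.toLinearMap.dualMap)
        (formMap (Ω.compContinuousLinearMap (ψ.restrictScalars ℝ)) u)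
      = φ (reMap σ (formMap Ω (ψ u))) := by
  have h : formMap (Ω.compContinuousLinearMap (ψ.restrictScalars ℝ)) u
      ∘ₗ φ.toLinearMap.restrictScalars ℝ = formMap Ω (ψ u) := by
    ext v
    change formMap (Ω.compContinuousLinearMap (ψ.restrictScalars ℝ)) u (φ v) = _
    rw [formMap_compContinuousLinearMap]
    simp [hψφ]
  rw [reMap_compLinearMap, h]
  rfl

/-- `σ` is transported by `φ` and `Ω` by its inverse `ψ`, so `Q Ω`, and with it `J_-`, is conjugated
by `φ`. -/
theorem minusJ_comp (hψφ : ∀ v, ψ (φ v) = v) (hφψ : ∀ u, φ (ψ u) = u) (σ : AntiCanonical V)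
    (Ω : V [⋀^Fin 2]→L[ℝ] ℝ) (u : V') :
    minusJ (σ.compLinearMap φ.toLinearMap.dualMap)
        (Ω.compContinuousLinearMap (ψ.restrictScalars ℝ)) u
      = φ (minusJ σ Ω (ψ u)) := by
  rw [minusJ_apply, minusJ_apply, reMap_formMap_comp hψφ, map_sub, map_neg, mulI_apply,
    mulI_apply, map_smul, hφψ]

theorem HitchinEquation.comp {σ : AntiCanonical V} {Ω : V [⋀^Fin 2]→L[ℝ] ℝ}
    (h : HitchinEquation σ Ω) (hψφ : ∀ v, ψ (φ v) = v) :
    HitchinEquation (σ.compLinearMap φ.toLinearMap.dualMap)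
      (Ω.compContinuousLinearMap (ψ.restrictScalars ℝ)) := by
  refine LinearMap.ext fun u => LinearMap.ext fun w => ?_
  have h1 := h.apply (ψ u) (ψ w)
  have h2 : ∀ f : V' →ₗ[ℝ] ℝ, mulIDual V' f w = - f (mulI V' w) := fun _ => rfl
  simp only [LinearMap.add_apply, LinearMap.sub_apply, LinearMap.comp_apply, h2,
    reMap_formMap_comp hψφ, formMap_compContinuousLinearMap,
    ContinuousLinearMap.coe_restrictScalars', hψφ, mulI_apply, map_smul, LinearMap.zero_apply,
    sub_neg_eq_add] at h1 ⊢
  exact h1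

end Pullback

/-! ### Differentials of holomorphic charts and the real tangent bundle. -/

section Charts

variable {E : Type*} [NormedAddCommGroup E] [NormedSpace ℂ E]
  {M : Type*} [TopologicalSpace M] [ChartedSpace E M] [IsManifold 𝓘(ℂ, E) ∞ M]
  {e : OpenPartialHomeomorph M E}

theorem dChart_dChartSymm (he : e ∈ atlas E M) {y : E} (hy : y ∈ e.target) (u : E) :
    dChart e (e.symm y) (dChartSymm e y u) = u := by
  have : IsManifold 𝓘(ℂ, E) 1 M := IsManifold.of_le (n := ∞) (by norm_num)
  have h := (mdifferentiable_of_mem_atlas (I := 𝓘(ℂ, E)) he).symm.symm_comp_deriv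
    (x := y) hy
  exact congrArg (fun f : E →L[ℂ] E => f u) h

theorem dChartSymm_dChart [FiniteDimensional ℂ E] (he : e ∈ atlas E M) {y : E}
    (hy : y ∈ e.target) (v : TangentSpace 𝓘(ℂ, E) (e.symm y)) :
    dChartSymm e y (dChart e (e.symm y) v) = v := by
  have hinj : Function.Injective (dChartSymm e y) :=
    Function.LeftInverse.injective (dChart_dChartSymm he hy)
  have hsurj : Function.Surjective (dChartSymm e y) :=
    (LinearMap.injective_iff_surjective_of_finrank_eq_finrank (f := (dChartSymm e y).toLinearMap)
      rfl).1 hinj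
  obtain ⟨u, rfl⟩ := hsurj v
  rw [dChart_dChartSymm he hy]

theorem dChartSymm_injective (he : e ∈ atlas E M) {y : E} (hy : y ∈ e.target) :
    Function.Injective (dChartSymm e y) :=
  Function.LeftInverse.injective (dChart_dChartSymm he hy)

omit [IsManifold 𝓘(ℂ, E) ∞ M] in
/-- A complex differentiable map between complex manifolds is differentiable between the
underlying real manifolds, with the same differential. -/
theorem hasMFDerivAt_real {M' : Type*} [TopologicalSpace M'] [ChartedSpace E M'] {f : M → M'}
    {x : M} {f' : TangentSpace 𝓘(ℂ, E) x →L[ℂ] TangentSpace 𝓘(ℂ, E) (f x)}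
    (h : HasMFDerivAt 𝓘(ℂ, E) 𝓘(ℂ, E) f x f') :
    HasMFDerivAt 𝓘(ℝ, E) 𝓘(ℝ, E) f x (f'.restrictScalars ℝ) :=
  ⟨h.1, HasFDerivWithinAt.restrictScalars ℝ h.2⟩

/-- Links the trivialization in which bundle smoothness is tested to the chart differential used in
the coordinate expressions. -/
theorem symmL_trivializationAt_eq_dChartSymm (x₀ : M) {x : M} (hx : x ∈ (chartAt E x₀).source)
    (u : E) :
    (trivializationAt E (TangentSpace 𝓘(ℝ, E)) x₀).symmL ℝ x u
      = dChartSymm (chartAt E x₀) (chartAt E x₀ x) u := by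
  have : IsManifold 𝓘(ℂ, E) 1 M := IsManifold.of_le (n := ∞) (by norm_num)
  have : IsManifold 𝓘(ℝ, E) 1 M := IsManifold.of_le (n := ∞) (by norm_num)
  have h := hasMFDerivAt_real (mdifferentiableAt_atlas_symm (I := 𝓘(ℂ, E))
    (chart_mem_atlas E x₀) ((chartAt E x₀).map_source hx)).hasMFDerivAt
  have h2 := TangentBundle.symmL_trivializationAt (I := 𝓘(ℝ, E)) hx
  have h3 : mfderivWithin 𝓘(ℝ, E) 𝓘(ℝ, E) (extChartAt 𝓘(ℝ, E) x₀).symm (Set.range 𝓘(ℝ, E))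
      (extChartAt 𝓘(ℝ, E) x₀ x)
      = (dChartSymm (chartAt E x₀) (chartAt E x₀ x)).restrictScalars ℝ := by
    rw [modelWithCornersSelf_coe, Set.range_id, mfderivWithin_univ]
    exact h.mfderiv
  rw [h2]
  exact congrArg (fun f : E →L[ℝ] E => f u) h3

end Charts

/-! ### Riemannian metrics from chartwise smooth positive forms. -/

section Metric

variable {E : Type*} [NormedAddCommGroup E] [NormedSpace ℂ E] [FiniteDimensional ℂ E]

theorem isVonNBounded_of_pos (B : E →L[ℝ] E →L[ℝ] ℝ) (hB : ∀ v, v ≠ 0 → 0 < B v v) :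
    Bornology.IsVonNBounded ℝ {v | B v v < 1} := by
  have hc : Continuous fun v => B v v := by fun_prop
  rcases subsingleton_or_nontrivial E with hE | hE
  · exact (NormedSpace.isVonNBounded_iff ℝ).2 (Set.toFinite _).isBounded
  have : ProperSpace E := FiniteDimensional.proper ℝ E
  obtain ⟨v₀, hv₀, hmin⟩ := (isCompact_sphere (0 : E) 1).exists_isMinOn
    (NormedSpace.sphere_nonempty.2 zero_le_one) hc.continuousOn
  have hv₀' : ‖v₀‖ = 1 := by simpa using hv₀
  have hm : 0 < B v₀ v₀ := hB v₀ (by rintro rfl; simp at hv₀')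
  have hlow : ∀ v, ‖v‖ ^ 2 * B v₀ v₀ ≤ B v v := by
    intro v
    rcases eq_or_ne v 0 with rfl | hv
    · simp
    have hn : ‖v‖ ≠ 0 := norm_ne_zero_iff.2 hv
    have h1 : B v₀ v₀ ≤ B (‖v‖⁻¹ • v) (‖v‖⁻¹ • v) := hmin (by simp [norm_smul, hn])
    simp only [map_smul, _root_.smul_apply, smul_eq_mul] at h1
    calc ‖v‖ ^ 2 * B v₀ v₀ ≤ ‖v‖ ^ 2 * (‖v‖⁻¹ * (‖v‖⁻¹ * B v v)) := by gcongr
      _ = B v v := by field_simp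
  refine (NormedSpace.isVonNBounded_iff ℝ).2
    ((Metric.isBounded_closedBall (x := (0 : E)) (r := 1 + (B v₀ v₀)⁻¹)).subset fun v hv => ?_)
  rw [Metric.mem_closedBall, dist_zero_right]
  have h1 : ‖v‖ ^ 2 < (B v₀ v₀)⁻¹ := by
    rw [← one_div, lt_div_iff₀ hm]
    exact (hlow v).trans_lt hv
  -- The radius `1 + 1/m`, with `m` the minimum of the form on the unit sphere, works since `2‖v‖ ≤
  -- 1 + ‖v‖²` and `‖v‖² < 1/m`.
  nlinarith [sq_nonneg (‖v‖ - 1)]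

variable {M : Type*} [TopologicalSpace M] [ChartedSpace E M] [IsManifold 𝓘(ℂ, E) ∞ M]

/-- A field of positive definite symmetric bilinear forms which is smooth in the charts is a
Riemannian metric. -/
theorem exists_riemMetric
    (b : ∀ x : M, TangentSpace 𝓘(ℂ, E) x →ₗ[ℝ] Module.Dual ℝ (TangentSpace 𝓘(ℂ, E) x))
    (hsymm : ∀ x v w, b x v w = b x w v) (hpos : ∀ x v, v ≠ 0 → 0 < b x v v)
    (hsmooth : ∀ e ∈ atlas E M, ∀ u v, ContDiffOn ℝ ∞ (fun y => bilinInChart e b y u v) e.target) :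
    ∃ h : RiemMetric E M, ∀ x, ∀ v w : TangentSpace 𝓘(ℂ, E) x, h.inner x v w = b x v w := by
  let B : M → E →L[ℝ] E →L[ℝ] ℝ := fun x => bilinCLM (E := E) (b x)
  let B' : ∀ x, TangentSpace 𝓘(ℝ, E) x →L[ℝ] TangentSpace 𝓘(ℝ, E) x →L[ℝ] ℝ := B
  refine ⟨{ inner := B'
            symm := fun x v w => hsymm x v w
            pos := fun x v hv => hpos x v hv
            isVonNBounded := fun x => isVonNBounded_of_pos (B x) (hpos x)
            contMDiff := fun x₀ => ?_ }, fun x v w => rfl⟩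
  rw [contMDiffAt_hom_bundle]
  refine ⟨contMDiffAt_id, ?_⟩
  set e := chartAt E x₀
  let S : E → E →L[ℝ] E := fun y => (dChartSymm e y).restrictScalars ℝ
  let G : E → E →L[ℝ] E →L[ℝ] ℝ := fun y =>
    (ContinuousLinearMap.precomp ℝ (S y)).comp ((B (e.symm y)).comp (S y))
  have hG : ContDiffOn ℝ ∞ G e.target := by
    rw [contDiffOn_clm_apply]
    intro u
    rw [contDiffOn_clm_apply]
    intro v
    exact hsmooth e (chart_mem_atlas E x₀) u v
  have hx₀ : x₀ ∈ e.source := mem_chart_source E x₀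
  have hGe : ContMDiffAt 𝓘(ℝ, E) 𝓘(ℝ, E →L[ℝ] E →L[ℝ] ℝ) ∞ (G ∘ e) x₀ :=
    ((hG.contDiffAt (e.open_target.mem_nhds (e.map_source hx₀))).contMDiffAt).comp x₀
      ((contMDiffOn_chart (I := 𝓘(ℝ, E))).contMDiffAt (e.open_source.mem_nhds hx₀))
  refine hGe.congr_of_eventuallyEq ?_
  filter_upwards [e.open_source.mem_nhds hx₀] with x hx
  ext u v
  have hx' : x ∈ (trivializationAt E (TangentSpace 𝓘(ℝ, E)) x₀).baseSet := hx
  refine (inCoordinates_apply_eq₂ (E₁ := TangentSpace 𝓘(ℝ, E)) (E₂ := TangentSpace 𝓘(ℝ, E))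
    (E₃ := fun _ : M => ℝ) (ϕ := B' x) hx' hx' (Set.mem_univ x)).trans ?_
  have hs := symmL_trivializationAt_eq_dChartSymm x₀ hx
  -- `e.symm (e x) = x` is only a propositional equality of base points; with every tangent space
  -- read as `E` it can be substituted.
  have hb : ∀ z, z = x → ∀ a a' : E, B x a a' = B z a a' := by
    rintro z rfl a a'
    rfl
  have h1 := hb _ (e.left_inv hx) (S (e x) u) (S (e x) v)
  have hs' : ∀ w : E, (trivializationAt E (TangentSpace 𝓘(ℝ, E)) x₀).symm x w = S (e x) w :=
    fun w => (Bundle.Trivialization.symmL_apply _ hx' w).symm.trans (hs w)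
  have ht : ∀ t : ℝ, (trivializationAt ℝ (fun _ : M => ℝ) x₀).linearMapAt ℝ x t = t := by simp
  rw [hs', hs']
  exact (ht _).trans h1

end Metric

end BiHermitian

/-! ### Gluing over the trivializations of `L`, and the conformal class. -/

namespace BiHermitian

section Gluing

variable {V : Type*} [AddCommGroup V] [Module ℂ V] [TopologicalSpace V] [FiniteDimensional ℂ V]

theorem minusJ_smul (σ : AntiCanonical V) (Ω : V [⋀^Fin 2]→L[ℝ] ℝ) {r r' : ℝ} (h : r * r' = 1) :
    minusJ ((r : ℂ) • σ) (r' • Ω) = minusJ σ Ω := by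
  ext v
  rw [minusJ_apply, minusJ_apply, reMap_smul, formMap_smul, LinearMap.smul_apply,
    LinearMap.smul_apply, map_smul, smul_smul, h, one_smul]

end Gluing

section Global

variable {E : Type*} [NormedAddCommGroup E] [NormedSpace ℂ E]
  {M : Type*} [TopologicalSpace M] [ChartedSpace E M]
  {ι : Type*} {L : FlatRealLineBundle E M ι}

theorem FlatRealLineBundle.exists_mem (L : FlatRealLineBundle E M ι) (x : M) :
    ∃ i, x ∈ L.U i := by
  have h : x ∈ ⋃ i, L.U i := L.iUnion_U ▸ Set.mem_univ x
  simpa using h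

theorem FlatRealLineBundle.isOpen_chartDomain (L : FlatRealLineBundle E M ι) (i : ι)
    (e : OpenPartialHomeomorph M E) : IsOpen (L.chartDomain i e) :=
  e.isOpen_inter_preimage_symm (L.isOpen_U i)

theorem FlatRealLineBundle.exists_mem_chartDomain (L : FlatRealLineBundle E M ι)
    {e : OpenPartialHomeomorph M E} {y : E} (hy : y ∈ e.target) :
    ∃ i, y ∈ L.chartDomain i e := by
  obtain ⟨i, hi⟩ := L.exists_mem (e.symm y)
  exact ⟨i, hy, hi⟩

variable [IsManifold 𝓘(ℂ, E) ∞ M]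

theorem FlatRealLineBundle.contDiffOn_f (L : FlatRealLineBundle E M ι) (i : ι)
    {e : OpenPartialHomeomorph M E} (he : e ∈ atlas E M) :
    ContDiffOn ℝ ∞ (fun y => L.f i (e.symm y)) (L.chartDomain i e) := by
  have h1 := (contMDiffOn_symm_of_mem_maximalAtlas (I := 𝓘(ℝ, E)) (n := ∞)
    (IsManifold.subset_maximalAtlas he)).mono (t := L.chartDomain i e) Set.inter_subset_left
  exact ((L.smooth_f i).comp h1 fun y hy => hy.2).contDiffOn

variable [FiniteDimensional ℂ E] {σ : HolomorphicSection L} {Ω : DualValuedTwoForm L}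

variable (σ Ω) in
/-- The endomorphism field `J_- = - J - Q Ω`, computed in a trivialization chosen at each point. -/
noncomputable def minusJField (x : M) :
    TangentSpace 𝓘(ℂ, E) x →ₗ[ℝ] TangentSpace 𝓘(ℂ, E) x :=
  minusJ (σ.val (L.exists_mem x).choose x) (Ω.val (L.exists_mem x).choose x)

omit [IsManifold 𝓘(ℂ, E) ∞ M] in
theorem minusJField_eq {i : ι} {x : M} (hx : x ∈ L.U i) :
    minusJField σ Ω x = minusJ (σ.val i x) (Ω.val i x) := by
  have hj := (L.exists_mem x).choose_spec
  rw [minusJField, σ.glue _ i x ⟨hj, hx⟩, Ω.glue _ i x ⟨hj, hx⟩]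
  exact minusJ_smul _ _ (by rw [← Real.exp_add]; simp)

variable (σ Ω) in
/-- The local expressions of the `L^*`-valued tensor `g = - Ω (J - J_-) / 2`. -/
noncomputable def metricField (i : ι) (x : M) :
    TangentSpace 𝓘(ℂ, E) x →ₗ[ℝ] Module.Dual ℝ (TangentSpace 𝓘(ℂ, E) x) :=
  hermitianForm (Ω.val i x) (minusJField σ Ω x)

omit [IsManifold 𝓘(ℂ, E) ∞ M] in
theorem metricField_eq {i : ι} {x : M} (hx : x ∈ L.U i) :
    metricField σ Ω i x = hermitianForm (Ω.val i x) (minusJ (σ.val i x) (Ω.val i x)) := by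
  rw [metricField, minusJField_eq hx]

omit [IsManifold 𝓘(ℂ, E) ∞ M] in
theorem metricField_glue {i j : ι} {x : M} (hx : x ∈ L.U i ∩ L.U j) :
    metricField σ Ω i x = Real.exp (L.f j x - L.f i x) • metricField σ Ω j x := by
  rw [metricField, metricField, Ω.glue i j x hx, hermitianForm, hermitianForm, formMap_smul,
    LinearMap.smul_comp, smul_comm]

theorem endoInChart_minusJField {e : OpenPartialHomeomorph M E} (he : e ∈ atlas E M) {i : ι}
    {y : E} (hy : y ∈ L.chartDomain i e) :
    endoInChart e (minusJField σ Ω) y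
      = minusJ (anticanonicalInChart e (σ.val i) y) (formInChart e (Ω.val i) y) := by
  ext u
  have h := minusJ_comp (dChartSymm_dChart he hy.1) (dChart_dChartSymm he hy.1)
    (σ.val i (e.symm y)) (Ω.val i (e.symm y)) u
  rw [← minusJField_eq hy.2] at h
  exact h.symm

theorem isIntegrableComplexStructure_minusJField (hΩ : Ω.IsClosed)
    (hp : ∀ i, ∀ x ∈ L.U i, InvariantPartPosDef (Ω.val i x))
    (hr : ∀ i, ∀ x ∈ L.U i, HitchinEquation (σ.val i x) (Ω.val i x)) :
    IsIntegrableComplexStructure (minusJField σ Ω) := by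
  have hp' : ∀ i, ∀ e ∈ atlas E M, ∀ z ∈ L.chartDomain i e,
      InvariantPartPosDef (formInChart e (Ω.val i) z) := fun i e he z hz =>
    (hp i _ hz.2).comp (dChartSymm_injective he hz.1)
  have hr' : ∀ i, ∀ e ∈ atlas E M, ∀ z ∈ L.chartDomain i e,
      HitchinEquation (anticanonicalInChart e (σ.val i) z) (formInChart e (Ω.val i) z) :=
    fun i e he z hz => (hr i _ hz.2).comp (dChartSymm_dChart he hz.1)
  refine ⟨fun x => ?_, fun e he v y hy => ?_, fun e he y hy u v => ?_⟩
  · obtain ⟨i, hi⟩ := L.exists_mem x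
    ext v
    rw [minusJField_eq hi]
    exact (hr i x hi).minusJ_minusJ v
  · obtain ⟨i, hi⟩ := L.exists_mem_chartDomain hy
    have h := (contDiffOn_minusJ (Ω.smooth i e he) (hp' i e he) (hr' i e he) v).congr
      (f₁ := fun z => endoInChart e (minusJField σ Ω) z v) fun z hz => by
        rw [endoInChart_minusJField he hz]
    exact (h.contDiffAt ((L.isOpen_chartDomain i e).mem_nhds hi)).contDiffWithinAt
  · obtain ⟨i, hi⟩ := L.exists_mem_chartDomain hy
    have hnhds := (L.isOpen_chartDomain i e).mem_nhds hi
    have h := nijenhuis_minusJ (σ := anticanonicalInChart e (σ.val i))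
      (L.isOpen_chartDomain i e) (Ω.smooth i e he) hi (hΩ i e he y hi) (hp' i e he)
      (hr' i e he) (fun α β => (σ.holomorphic i e he α β).differentiableAt hnhds) u v
    have hev : ∀ w : E, (fun z => endoInChart e (minusJField σ Ω) z w) =ᶠ[nhds y]
        fun z => minusJ (anticanonicalInChart e (σ.val i) z) (formInChart e (Ω.val i) z) w := by
      intro w
      filter_upwards [hnhds] with z hz
      rw [endoInChart_minusJField he hz]
    -- The Nijenhuis expression depends only on the germ of the endomorphism field at `y`.
    rw [nijenhuis] at h ⊢
    rw [(hev u).lieBracket_vectorField_eq (hev v),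
      (hev u).lieBracket_vectorField_eq (Filter.EventuallyEq.refl _ fun _ => v),
      (Filter.EventuallyEq.refl _ fun _ => u).lieBracket_vectorField_eq (hev v),
      endoInChart_minusJField he hi]
    exact h

omit [IsManifold 𝓘(ℂ, E) ∞ M] in
theorem contDiffOn_bilinInChart_metricField
    (hr : ∀ i, ∀ x ∈ L.U i, HitchinEquation (σ.val i x) (Ω.val i x)) (i : ι)
    {e : OpenPartialHomeomorph M E} (he : e ∈ atlas E M) (u v : E) :
    ContDiffOn ℝ ∞ (fun y => bilinInChart e (metricField σ Ω i) y u v) (L.chartDomain i e) := by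
  have h1 := contDiffOn_formCLM (Ω.smooth i e he)
  have h2 : ContDiffOn ℝ ∞ (fun y => (formCLM (formInChart e (Ω.val i) y) u (mulI E v)
      - formCLM (formInChart e (Ω.val i) y) (mulI E u) v) / 2) (L.chartDomain i e) :=
    (((h1.clm_apply contDiffOn_const).clm_apply contDiffOn_const).sub
      ((h1.clm_apply contDiffOn_const).clm_apply contDiffOn_const)).div_const 2
  refine h2.congr fun y hy => ?_
  have hJ : ∀ w : E, dChartSymm e y (mulI E w) = mulI _ (dChartSymm e y w) :=
    fun w => map_smul _ _ _
  rw [bilinInChart, metricField_eq hy.2, (hr i _ hy.2).hermitianForm_apply, formCLM_apply,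
    formCLM_apply, formInChart, formMap_compContinuousLinearMap, formMap_compContinuousLinearMap]
  simp only [ContinuousLinearMap.coe_restrictScalars', hJ]

omit [IsManifold 𝓘(ℂ, E) ∞ M] in
theorem isDualValuedSymmetricTensor_metricField
    (hr : ∀ i, ∀ x ∈ L.U i, HitchinEquation (σ.val i x) (Ω.val i x)) :
    IsDualValuedSymmetricTensor L (metricField σ Ω) where
  glue _ _ _ hx := metricField_glue hx
  smooth i _ he u v := contDiffOn_bilinInChart_metricField hr i he u v
  symm i x hx v w := by
    rw [metricField_eq hx]
    exact (hr i x hx).hermitianForm_symm v w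

/-- The metric `exp (f i) g i`, which does not depend on the trivialization. -/
theorem exists_riemMetric_metricField
    (hp : ∀ i, ∀ x ∈ L.U i, InvariantPartPosDef (Ω.val i x))
    (hr : ∀ i, ∀ x ∈ L.U i, HitchinEquation (σ.val i x) (Ω.val i x)) :
    ∃ h₀ : RiemMetric E M, ∀ i, ∀ x ∈ L.U i, ∀ v w : TangentSpace 𝓘(ℂ, E) x,
      h₀.inner x v w = Real.exp (L.f i x) * metricField σ Ω i x v w := by
  let b : ∀ x : M, TangentSpace 𝓘(ℂ, E) x →ₗ[ℝ] Module.Dual ℝ (TangentSpace 𝓘(ℂ, E) x) :=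
    fun x => Real.exp (L.f (L.exists_mem x).choose x) • metricField σ Ω (L.exists_mem x).choose x
  have hb : ∀ i, ∀ x ∈ L.U i, ∀ v w : TangentSpace 𝓘(ℂ, E) x,
      b x v w = Real.exp (L.f i x) * metricField σ Ω i x v w := by
    intro i x hx v w
    have hj := (L.exists_mem x).choose_spec
    change (Real.exp (L.f (L.exists_mem x).choose x)
      • metricField σ Ω (L.exists_mem x).choose x) v w = _
    rw [metricField_glue ⟨hj, hx⟩, smul_smul, ← Real.exp_add, add_sub_cancel]
    rfl
  have key : ∃ h₀ : RiemMetric E M, ∀ x, ∀ v w : TangentSpace 𝓘(ℂ, E) x,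
      h₀.inner x v w = b x v w := by
    refine exists_riemMetric b (fun x v w => ?_) (fun x v hv => ?_) (fun e he u v y hy => ?_)
    · obtain ⟨i, hi⟩ := L.exists_mem x
      rw [hb i x hi, hb i x hi, (isDualValuedSymmetricTensor_metricField hr).symm i x hi]
    · obtain ⟨i, hi⟩ := L.exists_mem x
      rw [hb i x hi, metricField_eq hi]
      exact mul_pos (Real.exp_pos _) ((hr i x hi).hermitianForm_pos (hp i x hi) hv)
    · obtain ⟨i, hi⟩ := L.exists_mem_chartDomain hy
      have h := ((Real.contDiff_exp.comp_contDiffOn (L.contDiffOn_f i he)).mul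
        (contDiffOn_bilinInChart_metricField hr i he u v)).congr
        (f₁ := fun z => bilinInChart e b z u v) fun z hz => hb i _ hz.2 _ _
      exact (h.contDiffAt ((L.isOpen_chartDomain i e).mem_nhds hi)).contDiffWithinAt
  obtain ⟨h₀, hh₀⟩ := key
  exact ⟨h₀, fun i x hx v w => (hh₀ x v w).trans (hb i x hx v w)⟩

/-- With `h₀ = exp(f i) g i`, multiples of `g i` and of `h₀` over `U i` differ by the smooth
positive factor `exp(f i)`. The local factors relative to `h₀` agree on overlaps, being ratios of
two global metrics. -/
theorem isConformalClass_metricsOf [Nontrivial E]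
    (hp : ∀ i, ∀ x ∈ L.U i, InvariantPartPosDef (Ω.val i x))
    (hr : ∀ i, ∀ x ∈ L.U i, HitchinEquation (σ.val i x) (Ω.val i x)) :
    IsConformalClass (metricsOf L (metricField σ Ω)) := by
  obtain ⟨h₀, hh₀⟩ := exists_riemMetric_metricField hp hr
  have hexp : ∀ i, ContMDiffOn 𝓘(ℝ, E) 𝓘(ℝ, ℝ) ∞ (fun x => Real.exp (L.f i x)) (L.U i) :=
    fun i => Real.contDiff_exp.contMDiff.comp_contMDiffOn (L.smooth_f i)
  have hexp' : ∀ i, ContMDiffOn 𝓘(ℝ, E) 𝓘(ℝ, ℝ) ∞ (fun x => Real.exp (-L.f i x)) (L.U i) :=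
    fun i => (Real.contDiff_exp.comp contDiff_neg).contMDiff.comp_contMDiffOn (L.smooth_f i)
  refine ⟨h₀, fun h => ⟨fun hc => ?_, ?_⟩⟩
  · obtain ⟨v₀, hv₀⟩ := exists_ne (0 : E)
    have hv : ∀ i, ∃ u : M → ℝ, ContMDiffOn 𝓘(ℝ, E) 𝓘(ℝ, ℝ) ∞ u (L.U i) ∧ ∀ x ∈ L.U i,
        0 < u x ∧ ∀ v w : TangentSpace 𝓘(ℂ, E) x, h.inner x v w = u x * h₀.inner x v w := by
      intro i
      obtain ⟨u, hu, hu'⟩ := hc i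
      refine ⟨fun x => u x * Real.exp (-L.f i x), hu.smul (hexp' i), fun x hx =>
        ⟨mul_pos (hu' x hx).1 (Real.exp_pos _), fun v w => ?_⟩⟩
      rw [(hu' x hx).2, hh₀ i x hx, mul_assoc, ← mul_assoc (Real.exp _), ← Real.exp_add,
        neg_add_cancel, Real.exp_zero, one_mul]
    choose u hu hu' using hv
    have heq : ∀ i, ∀ x ∈ L.U i, h.inner x v₀ v₀ / h₀.inner x v₀ v₀ = u i x := by
      intro i x hx
      rw [(hu' i x hx).2 v₀ v₀]
      exact mul_div_cancel_right₀ _ (h₀.pos x v₀ hv₀).ne'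
    refine ⟨fun x => h.inner x v₀ v₀ / h₀.inner x v₀ v₀, fun x => ?_, fun x => ?_⟩
    · obtain ⟨i, hi⟩ := L.exists_mem x
      exact ((hu i).congr (heq i)).contMDiffAt ((L.isOpen_U i).mem_nhds hi)
    · obtain ⟨i, hi⟩ := L.exists_mem x
      simp only [heq i x hi]
      exact hu' i x hi
  · rintro ⟨u, hu, hu'⟩ i
    refine ⟨fun x => u x * Real.exp (L.f i x), hu.contMDiffOn.smul (hexp i), fun x hx =>
      ⟨mul_pos (hu' x).1 (Real.exp_pos _), fun v w => ?_⟩⟩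
    exact ((hu' x).2 v w).trans
      ((congrArg (u x * ·) (hh₀ i x hx v w)).trans (mul_assoc _ _ _).symm)

omit [FiniteDimensional ℂ E] in
/-- A field of endomorphisms preserving the tensor `g` is orthogonal for the metrics of `[g]`. -/
theorem isOrthogonalFor_metricsOf
    {A : ∀ x : M, TangentSpace 𝓘(ℂ, E) x →ₗ[ℝ] TangentSpace 𝓘(ℂ, E) x}
    {g : ι → ∀ x : M, TangentSpace 𝓘(ℂ, E) x →ₗ[ℝ] Module.Dual ℝ (TangentSpace 𝓘(ℂ, E) x)}
    (hA : ∀ i, ∀ x ∈ L.U i, ∀ v w, g i x (A x v) (A x w) = g i x v w) :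
    IsOrthogonalFor A (metricsOf L g) := by
  intro h hc x v w
  obtain ⟨i, hi⟩ := L.exists_mem x
  obtain ⟨u, -, hu⟩ := hc i
  rw [(hu x hi).2, (hu x hi).2, hA i x hi]

end Global

end BiHermitian

theorem mainTheorem2
    {E : Type*} [NormedAddCommGroup E] [NormedSpace ℂ E] [FiniteDimensional ℂ E]
    (hE : Module.finrank ℂ E = 2)
    {M : Type*} [TopologicalSpace M] [T2Space M] [CompactSpace M]
    [ChartedSpace E M] [IsManifold 𝓘(ℂ, E) ∞ M]
    {ι : Type*} (L : BiHermitian.FlatRealLineBundle E M ι)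
    (σ : BiHermitian.HolomorphicSection L)
    (Ω : BiHermitian.DualValuedTwoForm L) (hΩ : Ω.IsClosed)
    (hpos : ∀ i, ∀ x ∈ L.U i, BiHermitian.InvariantPartPosDef (Ω.val i x))
    (hQ : ∀ i, ∀ x ∈ L.U i,
      BiHermitian.formMap (Ω.val i x) ∘ₗ BiHermitian.stdJ E M x
        - BiHermitian.mulIDual (TangentSpace 𝓘(ℂ, E) x) ∘ₗ BiHermitian.formMap (Ω.val i x)
        + BiHermitian.formMap (Ω.val i x) ∘ₗ BiHermitian.reMap (σ.val i x)
            ∘ₗ BiHermitian.formMap (Ω.val i x) = 0) :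
    ∃ Jm : ∀ x : M, TangentSpace 𝓘(ℂ, E) x →ₗ[ℝ] TangentSpace 𝓘(ℂ, E) x,
      (∀ i, ∀ x ∈ L.U i,
        Jm x = - BiHermitian.stdJ E M x
          - BiHermitian.reMap (σ.val i x) ∘ₗ BiHermitian.formMap (Ω.val i x)) ∧
      BiHermitian.IsIntegrableComplexStructure Jm ∧
      ∃ g : ι → ∀ x : M,
          TangentSpace 𝓘(ℂ, E) x →ₗ[ℝ] Module.Dual ℝ (TangentSpace 𝓘(ℂ, E) x),
        (∀ i x, g i x = (-(1 / 2) : ℝ) •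
          (BiHermitian.formMap (Ω.val i x) ∘ₗ (BiHermitian.stdJ E M x - Jm x))) ∧
        BiHermitian.IsDualValuedSymmetricTensor L g ∧
        BiHermitian.IsConformalClass (BiHermitian.metricsOf L g) ∧
        BiHermitian.IsOrthogonalFor (BiHermitian.stdJ E M) (BiHermitian.metricsOf L g) ∧
        BiHermitian.IsOrthogonalFor Jm (BiHermitian.metricsOf L g) ∧
        ∀ x, BiHermitian.stdJ E M x ≠ Jm x := by
  have : Nontrivial E := Module.nontrivial_of_finrank_pos (R := ℂ) (by omega)
  have hr : ∀ i, ∀ x ∈ L.U i, BiHermitian.HitchinEquation (σ.val i x) (Ω.val i x) := hQ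
  refine ⟨BiHermitian.minusJField σ Ω, fun i x hx => BiHermitian.minusJField_eq hx,
    BiHermitian.isIntegrableComplexStructure_minusJField hΩ hpos hr,
    BiHermitian.metricField σ Ω, fun i x => rfl,
    BiHermitian.isDualValuedSymmetricTensor_metricField hr,
    BiHermitian.isConformalClass_metricsOf hpos hr,
    BiHermitian.isOrthogonalFor_metricsOf fun i x hx v w => ?_,
    BiHermitian.isOrthogonalFor_metricsOf fun i x hx v w => ?_, fun x => ?_⟩
  · rw [BiHermitian.metricField_eq hx]
    exact (hr i x hx).hermitianForm_mulI v w
  · rw [BiHermitian.metricField_eq hx, BiHermitian.minusJField_eq hx]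
    exact (hr i x hx).hermitianForm_minusJ v w
  · obtain ⟨i, hi⟩ := L.exists_mem x
    have : Nontrivial (TangentSpace 𝓘(ℂ, E) x) := inferInstanceAs (Nontrivial E)
    rw [BiHermitian.minusJField_eq hi]
    exact (hr i x hi).mulI_ne_minusJ (hpos i x hi)
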